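/- Let $X$ and $Y$ be Polish spaces and let $U$ be a metrizable space. Let $\mathcal P(X)$ and $\mathcal P(Y)$ be the sets of Borel probability measures, with the narrow topology (convergence against bounded continuous functions), and let $C^0(X\times Y,U)$ be the space of continuous maps $X\times Y\to U$ with the compact-open topology (uniform convergence on compact sets). Let $l: X\times U\times Y\to[0,\infty]$ be such that - for every $y\in Y$ the function $(x,u)\mapsto l(x,u,y)$ is lower semicontinuous on $X\times U$, and - for every $u\in C^0(X\times Y,U)$ the function $(x,y)\mapsto l(x,u(x,y),y)$ is Borel measurable (this holds, for instance, if $l$ is Borel measurable). For $\mu^\ast\in\mathcal P(Y)$ define $$L_{\mu^\ast}:\mathcal P(X)\times C^0(X\times Y,U)\to[0,\infty],\qquad L_{\mu^\ast}(\mu,u)=\inf_{\gamma\in\Gamma(\mu,\mu^\ast)}\int_{X\times Y} l(x,u(x,y),y)\,\mathrm d\gamma(x,y),$$ where $\Gamma(\mu,\mu^\ast)$ is the set of Borel probability measures on $X\times Y$ with marginals $\mu$ and $\mu^\ast$. Then, for every $\mu^\ast\in\mathcal P(Y)$, the map $L_{\mu^\ast}$ is jointly (sequentially) lower semicontinuous: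 if $\mu_n\to\mu$ narrowly and $u_n\to u$ in $C^0(X\times Y,U)$, then $$L_{\mu^\ast}(\mu,u)\le\liminf_{n\to\infty}L_{\mu^\ast}(\mu_n,u_n).$$ If moreover $X$ and $Y$ are locally compact, then $L_{\mu^\ast}$ is lower semicontinuous with respect to the product topology on $\mathcal P(X)\times C^0(X\times Y,U)$. -/

import Mathlib

open MeasureTheory Filter Topology
open scoped ENNReal

/-- The set of couplings (transport plans) of `μ` and `ν`: the Borel probability measures on
`X × Y` with first marginal `μ` and second marginal `ν`. -/
def couplings {X Y : Type*} [MeasurableSpace X] [MeasurableSpace Y]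
    (μ : ProbabilityMeasure X) (ν : ProbabilityMeasure Y) :
    Set (ProbabilityMeasure (X × Y)) :=
  {γ | (γ : Measure (X × Y)).map Prod.fst = (μ : Measure X) ∧
       (γ : Measure (X × Y)).map Prod.snd = (ν : Measure Y)}

/-- The lifted cost `(μ, u) ↦ inf_γ ∫ l (x, u (x, y), y) dγ(x, y)`, the infimum being over the
couplings `γ` of `μ` and `μstar`. -/
noncomputable def liftedCost {X U Y : Type*} [TopologicalSpace X] [TopologicalSpace U]
    [TopologicalSpace Y] [MeasurableSpace X] [MeasurableSpace Y]
    (l : X × U × Y → ℝ≥0∞) (μstar : ProbabilityMeasure Y)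
    (q : ProbabilityMeasure X × C(X × Y, U)) : ℝ≥0∞ :=
  ⨅ γ ∈ couplings q.1 μstar, ∫⁻ p, l (p.1, q.2 p, p.2) ∂(γ : Measure (X × Y))

/-- Sequential lower semicontinuity of an extended nonnegative function: along every convergent
sequence, the value at the limit is at most the limit inferior of the values. -/
def SeqLowerSemicontinuous {E : Type*} [TopologicalSpace E] (f : E → ℝ≥0∞) : Prop :=
  ∀ (a : ℕ → E) (e : E), Tendsto a atTop (𝓝 e) → f e ≤ liminf (fun n => f (a n)) atTop

/-! The cost is semicontinuous in `(x, u)` but only measurable in `y`; the fixed second marginal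
compensates. A Borel set with open `x`-sections lies in an open set whose excess sits over a set of
`y` of small `μstar`-measure, and every plan gives that strip the same small bound. So the
portmanteau inequality survives (`measure_le_liminf_of_isOpen_section`) and passes to integrals by
layer cake. Building the open set needs analytic sets to be null measurable. Moving maps are
absorbed by tail infima of the costs, which increase to the limit cost (`lintegral_cost_le_liminf`).
Tightness supplies a limit of almost optimal plans. -/

/-! ### Null measurability of analytic sets -/

/-- A subset of the Baire space cut out by the first `k` coordinate bounds eventually enters any
open set containing the compact box cut out by all the bounds. -/
theorem exists_initial_box_subset {b : ℕ → ℕ} {O : Set (ℕ → ℕ)} (hO : IsOpen O)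
    (hb : {σ : ℕ → ℕ | ∀ i, σ i ≤ b i} ⊆ O) :
    ∃ k, {σ : ℕ → ℕ | ∀ i < k, σ i ≤ b i} ⊆ O := by
  by_contra! h
  simp only [Set.not_subset] at h
  choose σ hσ hσO using h
  have hK : IsCompact (Set.univ.pi fun i => Set.Iic (b i)) :=
    isCompact_univ_pi fun i => (Set.finite_Iic (b i)).isCompact
  -- Truncation forces the points into the compact box and leaves coordinate `i` unchanged once `k >
  -- i`.
  obtain ⟨τ, hτ, φ, hφ, hlim⟩ := hK.tendsto_subseq (x := fun k i => min (σ k i) (b i))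
    fun k i _ => Set.mem_Iic.2 (min_le_right _ _)
  have hlim' : Tendsto (fun k => σ (φ k)) atTop (𝓝 τ) := by
    rw [tendsto_pi_nhds] at hlim ⊢
    intro i
    refine (hlim i).congr' ?_
    filter_upwards [eventually_gt_atTop i] with k hk
    exact min_eq_left (hσ (φ k) i (hk.trans_le (hφ.id_le k)))
  have hτO : τ ∈ O := hb fun i => hτ i (Set.mem_univ i)
  obtain ⟨k, hk⟩ := (hlim'.eventually (hO.mem_nhds hτO)).exists
  exact hσO _ hk

/-- Analytic sets are inner regular for compact sets, with respect to finite measures. -/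
theorem MeasureTheory.AnalyticSet.exists_isCompact_measure_le_add {Y : Type*} [TopologicalSpace Y]
    [MeasurableSpace Y] {μ : Measure Y} [μ.OuterRegular] {s : Set Y} (hs : AnalyticSet s)
    {ε : ℝ≥0∞} (hε : ε ≠ 0) (hfin : μ s ≠ ∞) :
    ∃ K ⊆ s, IsCompact K ∧ μ s ≤ μ K + ε := by
  rw [AnalyticSet] at hs
  rcases hs with rfl | ⟨f, hf, rfl⟩
  · exact ⟨∅, subset_rfl, isCompact_empty, by simp⟩
  obtain ⟨δ, hδ, hδε⟩ := ENNReal.exists_pos_sum_of_countable hε ℕ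
  have step (A : Set (ℕ → ℕ)) (i : ℕ) :
      ∃ m, μ (f '' A) ≤ μ (f '' (A ∩ {σ | σ i ≤ m})) + δ i := by
    have hU : f '' A = ⋃ m, f '' (A ∩ {σ | σ i ≤ m}) := by
      rw [← Set.image_iUnion, ← Set.inter_iUnion]
      congr 1
      refine (Set.inter_eq_left.2 fun σ _ => Set.mem_iUnion.2 ⟨σ i, le_refl (σ i)⟩).symm
    have hmono : Monotone fun m => f '' (A ∩ {σ | σ i ≤ m}) := fun m m' h =>
      Set.image_mono fun σ hσ => ⟨hσ.1, le_trans hσ.2 h⟩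
    -- Continuity from below needs no measurability of these images.
    have hlim := tendsto_measure_iUnion_atTop (μ := μ) hmono
    rw [← hU] at hlim
    by_contra! hlt
    have h1 := le_of_tendsto (hlim.add_const (δ i : ℝ≥0∞)) (Eventually.of_forall fun m => (hlt m).le)
    have hA : μ (f '' A) ≠ ∞ := measure_ne_top_of_subset (Set.image_subset_range _ _) hfin
    exact (ENNReal.lt_add_right hA (by exact_mod_cast (hδ i).ne')).not_ge h1
  choose m hm using step
  let A : ℕ → Set (ℕ → ℕ) := fun k =>
    Nat.rec Set.univ (fun i B => B ∩ {σ | σ i ≤ m B i}) k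
  let b : ℕ → ℕ := fun i => m (A i) i
  have hA_succ (k) : A (k + 1) = A k ∩ {σ | σ k ≤ b k} := rfl
  have hA_eq (k) : A k = {σ | ∀ i < k, σ i ≤ b i} := by
    induction k with
    | zero => ext; simp [A]
    | succ k ih =>
      rw [hA_succ, ih]
      ext σ
      simp only [Set.mem_inter_iff, Set.mem_ofPred_eq, Nat.forall_lt_succ_right]
  have hA_le (k) : μ (Set.range f) ≤ μ (f '' A k) + ∑ i ∈ Finset.range k, (δ i : ℝ≥0∞) := by
    induction k with
    | zero => simp [A]
    | succ k ih =>
      refine ih.trans ?_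
      rw [Finset.sum_range_succ, add_comm (∑ i ∈ Finset.range k, (δ i : ℝ≥0∞)), ← add_assoc]
      gcongr
      exact hm (A k) k
  have hK : IsCompact {σ : ℕ → ℕ | ∀ i, σ i ≤ b i} := by
    convert! isCompact_univ_pi fun i => (Set.finite_Iic (b i)).isCompact using 1
    ext σ
    simp [Pi.le_def]
  refine ⟨f '' {σ | ∀ i, σ i ≤ b i}, Set.image_subset_range _ _, hK.image hf, ?_⟩
  refine tsub_le_iff_right.1 ?_
  -- Continuity from above is not available for the images `f '' A k`; outer regularity replaces it,
  -- as each open `O` around the compact image contains some `f '' A k`.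
  rw [Set.measure_eq_iInf_isOpen (f '' _)]
  refine le_iInf₂ fun O hO => le_iInf fun hOo => tsub_le_iff_right.2 ?_
  obtain ⟨k, hk⟩ := exists_initial_box_subset (hOo.preimage hf) (Set.image_subset_iff.1 hO)
  refine (hA_le k).trans ?_
  gcongr
  · rw [hA_eq]
    exact Set.image_subset_iff.2 hk
  · exact (ENNReal.sum_le_tsum _).trans hδε.le

/-- Analytic sets are measurable up to null sets for every finite Borel measure. -/
theorem MeasureTheory.AnalyticSet.nullMeasurableSet {Y : Type*} [TopologicalSpace Y] [T2Space Y]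
    [MeasurableSpace Y] [OpensMeasurableSpace Y] {μ : Measure Y} [IsFiniteMeasure μ]
    [μ.OuterRegular] {s : Set Y} (hs : AnalyticSet s) : NullMeasurableSet s μ := by
  have h (n : ℕ) := hs.exists_isCompact_measure_le_add (μ := μ) (ε := (n : ℝ≥0∞)⁻¹)
    (ENNReal.inv_ne_zero.2 (ENNReal.natCast_ne_top n)) (measure_ne_top μ s)
  choose K hKs hKc hK using h
  have hmeas : MeasurableSet (⋃ n, K n) := .iUnion fun n => (hKc n).measurableSet
  have hsub : ⋃ n, K n ⊆ s := Set.iUnion_subset hKs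
  have hle : μ s ≤ μ (⋃ n, K n) := by
    have hlim : Tendsto (fun n : ℕ => μ (⋃ n, K n) + (n : ℝ≥0∞)⁻¹) atTop (𝓝 (μ (⋃ n, K n))) := by
      simpa using tendsto_const_nhds.add ENNReal.tendsto_inv_nat_nhds_zero
    refine ge_of_tendsto' hlim fun n => (hK n).trans ?_
    gcongr
    exact Set.subset_iUnion K n
  have hae : (⋃ n, K n : Set Y) =ᵐ[μ] toMeasurable μ s :=
    ae_eq_of_subset_of_measure_ge (hsub.trans (subset_toMeasurable μ s))
      (by rwa [measure_toMeasurable]) hmeas.nullMeasurableSet (measure_ne_top _ _)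
  refine hmeas.nullMeasurableSet.congr ?_
  exact hsub.eventuallyLE.antisymm
    ((subset_toMeasurable μ s).eventuallyLE.trans hae.symm.le)

/-! ### Plans with a fixed second marginal -/

/-- A measurable set with open sections is contained in an open set whose excess lies over a set
of small measure. -/
theorem exists_isOpen_superset_diff_subset {X Y : Type*}
    [TopologicalSpace X] [PolishSpace X] [MeasurableSpace X] [BorelSpace X]
    [TopologicalSpace Y] [PolishSpace Y] [MeasurableSpace Y] [BorelSpace Y]
    (μ : Measure Y) [IsFiniteMeasure μ] {B : Set (X × Y)} (hB : MeasurableSet B)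
    (hsec : ∀ y, IsOpen {x | (x, y) ∈ B}) {ε : ℝ≥0∞} (hε : ε ≠ 0) :
    ∃ (W : Set (X × Y)) (N : Set Y),
      IsOpen W ∧ B ⊆ W ∧ W ⊆ B ∪ Prod.snd ⁻¹' N ∧ μ N ≤ ε := by
  obtain ⟨V, hVc, -, hV⟩ := TopologicalSpace.exists_countable_basis X
  have := hVc.to_subtype
  obtain ⟨δ, hδ, hδε⟩ := ENNReal.exists_pos_sum_of_countable hε V
  let E : V → Set Y := fun v => {y | ∀ x ∈ (v : Set X), (x, y) ∈ B}
  have hE (v : V) : NullMeasurableSet (E v) μ := by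
    -- The complement is a projection of a Borel set, hence analytic.
    have hc : (E v)ᶜ = Prod.snd '' (Prod.fst ⁻¹' (v : Set X) \ B) := by
      ext y
      simp [E]
    have hm : MeasurableSet (Prod.fst ⁻¹' (v : Set X) \ B) :=
      (measurable_fst (hV.isOpen v.2).measurableSet).diff hB
    have ha : AnalyticSet (E v)ᶜ := by
      rw [hc]
      exact hm.analyticSet.image_of_continuous continuous_snd
    exact ha.nullMeasurableSet.of_compl
  have hO (v : V) : ∃ O ⊇ E v, IsOpen O ∧ μ (O \ E v) ≤ δ v := by
    obtain ⟨O, hEO, hOo, hlt⟩ := (E v).exists_isOpen_lt_add (measure_ne_top μ _)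
      (ε := δ v) (by exact_mod_cast (hδ v).ne')
    refine ⟨O, hEO, hOo, ?_⟩
    rw [measure_sdiff hEO (hE v) (measure_ne_top μ _)]
    exact tsub_le_iff_left.2 hlt.le
  choose O hEO hOo hOδ using hO
  refine ⟨⋃ v : V, (v : Set X) ×ˢ O v, ⋃ v, O v \ E v, ?_, ?_, ?_, ?_⟩
  · exact isOpen_iUnion fun v => (hV.isOpen v.2).prod (hOo v)
  · rintro ⟨x, y⟩ hxy
    obtain ⟨v, hv, hxv, hvB⟩ := hV.exists_subset_of_mem_open (a := x) hxy (hsec y)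
    exact Set.mem_iUnion.2 ⟨⟨v, hv⟩, hxv, hEO ⟨v, hv⟩ fun x' hx' => hvB hx'⟩
  · rintro ⟨x, y⟩ hxy
    obtain ⟨v, hxv, hy⟩ := Set.mem_iUnion.1 hxy
    by_cases hyE : y ∈ E v
    · exact Or.inl (hyE x hxv)
    · exact Or.inr (Set.mem_iUnion.2 ⟨v, hy, hyE⟩)
  · refine (measure_iUnion_le _).trans ((ENNReal.tsum_le_tsum hOδ).trans hδε.le)

/-- Along narrowly convergent measures with a fixed second marginal, the measure of a measurable
set with open sections is lower semicontinuous. -/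
theorem measure_le_liminf_of_isOpen_section {X Y ι : Type*}
    [TopologicalSpace X] [PolishSpace X] [MeasurableSpace X] [BorelSpace X]
    [TopologicalSpace Y] [PolishSpace Y] [MeasurableSpace Y] [BorelSpace Y]
    {L : Filter ι} {ν : Measure Y} [IsFiniteMeasure ν] {γ : ProbabilityMeasure (X × Y)}
    {γs : ι → ProbabilityMeasure (X × Y)} (hlim : Tendsto γs L (𝓝 γ))
    (hsnd : ∀ i, (γs i : Measure (X × Y)).map Prod.snd = ν)
    {B : Set (X × Y)} (hB : MeasurableSet B) (hsec : ∀ y, IsOpen {x | (x, y) ∈ B}) :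
    (γ : Measure (X × Y)) B ≤ liminf (fun i => (γs i : Measure (X × Y)) B) L := by
  rcases L.eq_or_neBot with rfl | hL
  · simp [liminf, limsInf]
  refine ENNReal.le_of_forall_pos_le_add fun ε hε _ => ?_
  obtain ⟨W, N, hWo, hBW, hWB, hN⟩ := exists_isOpen_superset_diff_subset ν hB hsec
    (ε := ε) (by exact_mod_cast hε.ne')
  calc (γ : Measure (X × Y)) B ≤ (γ : Measure (X × Y)) W := measure_mono hBW
    _ ≤ liminf (fun i => (γs i : Measure (X × Y)) W) L :=
      ProbabilityMeasure.le_liminf_measure_open_of_tendsto hlim hWo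
    _ ≤ liminf (fun i => (γs i : Measure (X × Y)) B + ε) L := by
      refine liminf_le_liminf (Eventually.of_forall fun i => ?_)
      refine (measure_mono hWB).trans ((measure_union_le _ _).trans ?_)
      gcongr
      refine (Measure.le_map_apply measurable_snd.aemeasurable N).trans ?_
      rwa [hsnd i]
    _ = liminf (fun i => (γs i : Measure (X × Y)) B) L + ε :=
      liminf_add_const L _ _ (by isBoundedDefault) (by isBoundedDefault)

/-- The layer cake formula for functions with values in `ℝ≥0∞`. -/
theorem lintegral_eq_lintegral_Ioi_measure_lt {Ω : Type*} [MeasurableSpace Ω] (μ : Measure Ω)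
    [SFinite μ] {f : Ω → ℝ≥0∞} (hf : Measurable f) :
    ∫⁻ p, f p ∂μ = ∫⁻ t in Set.Ioi (0 : ℝ), μ {p | ENNReal.ofReal t < f p} := by
  have hS : MeasurableSet {q : Ω × ℝ | ENNReal.ofReal q.2 < f q.1} :=
    measurableSet_lt (ENNReal.measurable_ofReal.comp measurable_snd) (hf.comp measurable_fst)
  have h1 := Measure.prod_apply (μ := μ) (ν := volume.restrict (Set.Ioi (0 : ℝ))) hS
  rw [Measure.prod_apply_symm hS] at h1
  refine Eq.trans (lintegral_congr fun p => ?_) h1.symm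
  have hset : MeasurableSet (Prod.mk p ⁻¹' {q : Ω × ℝ | ENNReal.ofReal q.2 < f q.1}) :=
    measurable_prodMk_left hS
  rw [Measure.restrict_apply hset]
  rcases eq_or_ne (f p) ∞ with hp | hp
  · have : Prod.mk p ⁻¹' {q : Ω × ℝ | ENNReal.ofReal q.2 < f q.1} ∩ Set.Ioi 0 = Set.Ioi 0 := by
      ext t; simp [hp]
    rw [this, Real.volume_Ioi, hp]
  · have : Prod.mk p ⁻¹' {q : Ω × ℝ | ENNReal.ofReal q.2 < f q.1} ∩ Set.Ioi 0
        = Set.Ioo 0 (f p).toReal := by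
      ext t
      simp only [Set.mem_inter_iff, Set.mem_preimage, Set.mem_ofPred_eq, Set.mem_Ioi, Set.mem_Ioo]
      rw [and_comm]
      refine and_congr_right fun ht => ?_
      rw [ENNReal.ofReal_lt_iff_lt_toReal ht.le hp]
    rw [this, Real.volume_Ioo, sub_zero, ENNReal.ofReal_toReal hp]

/-- Along narrowly convergent measures with a fixed second marginal, integrals of nonnegative
measurable functions that are lower semicontinuous in the first variable are lower
semicontinuous. -/
theorem lintegral_le_liminf_of_lowerSemicontinuous_section {X Y : Type*}
    [TopologicalSpace X] [PolishSpace X] [MeasurableSpace X] [BorelSpace X]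
    [TopologicalSpace Y] [PolishSpace Y] [MeasurableSpace Y] [BorelSpace Y]
    {ν : Measure Y} [IsFiniteMeasure ν] {γ : ProbabilityMeasure (X × Y)}
    {γs : ℕ → ProbabilityMeasure (X × Y)} (hlim : Tendsto γs atTop (𝓝 γ))
    (hsnd : ∀ i, (γs i : Measure (X × Y)).map Prod.snd = ν)
    {f : X × Y → ℝ≥0∞} (hf : Measurable f)
    (hsec : ∀ y, LowerSemicontinuous fun x => f (x, y)) :
    ∫⁻ p, f p ∂(γ : Measure (X × Y))
      ≤ liminf (fun i => ∫⁻ p, f p ∂(γs i : Measure (X × Y))) atTop := by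
  simp_rw [lintegral_eq_lintegral_Ioi_measure_lt _ hf]
  -- Set-wise semicontinuity at each level `t`, then Fatou in `t`.
  refine le_trans (lintegral_mono fun t => ?_) (lintegral_liminf_le fun i => ?_)
  · exact measure_le_liminf_of_isOpen_section hlim hsnd (measurableSet_lt measurable_const hf)
      fun y => (hsec y).isOpen_preimage _
  · refine Antitone.measurable fun s t hst => measure_mono fun p hp => ?_
    exact (ENNReal.ofReal_le_ofReal hst).trans_lt hp

/-! ### Convergent maps and tail infima -/

/-- Evaluation is sequentially continuous for the compact-open topology. -/
theorem ContinuousMap.tendsto_apply_of_tendsto_seq {Z U : Type*} [TopologicalSpace Z]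
    [TopologicalSpace U] {u : ℕ → C(Z, U)} {v : C(Z, U)} (hu : Tendsto u atTop (𝓝 v))
    {z : ℕ → Z} {w : Z} (hz : Tendsto z atTop (𝓝 w)) :
    Tendsto (fun n => u n (z n)) atTop (𝓝 (v w)) := by
  refine tendsto_nhds.2 fun O hO hw => ?_
  obtain ⟨N, hN⟩ := eventually_atTop.1
    (hz.eventually (v.continuous.continuousAt.eventually (hO.mem_nhds hw)))
  have hK := ((tendsto_add_atTop_iff_nat N).2 hz).isCompact_insert_range
  have hmaps : Set.MapsTo v (insert w (Set.range fun n => z (n + N))) O := by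
    rintro _ (rfl | ⟨n, rfl⟩)
    · exact hw
    · exact hN _ (Nat.le_add_left _ _)
  filter_upwards [tendsto_nhds_compactOpen.1 hu _ hK _ hO hmaps, eventually_ge_atTop N]
    with n hn hNn
  exact hn (Or.inr ⟨n - N, by simp [Nat.sub_add_cancel hNn]⟩)

/-- A sequence converging in the compact-open topology on a first countable space converges
jointly with the argument. -/
theorem ContinuousMap.tendsto_uncurry_of_tendsto {Z U : Type*} [TopologicalSpace Z]
    [FirstCountableTopology Z] [TopologicalSpace U] {u : ℕ → C(Z, U)} {v : C(Z, U)}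
    (hu : Tendsto u atTop (𝓝 v)) (w : Z) :
    Tendsto (fun q : ℕ × Z => u q.1 q.2) (atTop ×ˢ 𝓝 w) (𝓝 (v w)) := by
  refine tendsto_of_seq_tendsto fun q hq => ?_
  rw [tendsto_prod_iff'] at hq
  exact tendsto_apply_of_tendsto_seq (hu.comp hq.1) hq.2

/-- The infimum of the values of a lower semicontinuous function along the tail of a convergent
sequence of maps together with its limit is lower semicontinuous. -/
theorem lowerSemicontinuous_inf_iInf_tail {X U : Type*} [TopologicalSpace X] [TopologicalSpace U]
    {h : X × U → ℝ≥0∞} (hh : LowerSemicontinuous h) {f : ℕ → X → U} {g : X → U}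
    (hf : ∀ n, Continuous (f n)) (hg : Continuous g)
    (hfg : ∀ x, Tendsto (fun q : ℕ × X => f q.1 q.2) (atTop ×ˢ 𝓝 x) (𝓝 (g x))) (k : ℕ) :
    LowerSemicontinuous fun x => h (x, g x) ⊓ ⨅ n, h (x, f (n + k) x) := by
  intro x c hc
  -- An infimum of values `> c'` is only `≥ c'`, so room above `c` is needed. Indices below `N` are
  -- treated one by one, the others by joint convergence.
  obtain ⟨c', hcc', hc'⟩ := exists_between hc
  have hlim : Tendsto (fun q : ℕ × X => (q.2, f q.1 q.2)) (atTop ×ˢ 𝓝 x) (𝓝 (x, g x)) :=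
    tendsto_snd.prodMk_nhds (hfg x)
  have hev := hlim.eventually (hh (x, g x) c' (hc'.trans_le inf_le_left))
  obtain ⟨p, hp, q, hq, hpq⟩ := eventually_prod_iff.1 hev
  obtain ⟨N, hN⟩ := eventually_atTop.1 hp
  have hfin : ∀ᶠ x' in 𝓝 x, ∀ n ∈ Finset.range N, c' < h (x', f (n + k) x') := by
    refine (Finset.eventually_all _).2 fun n _ => ?_
    have hn : Tendsto (fun x' => (x', f (n + k) x')) (𝓝 x) (𝓝 (x, f (n + k) x)) :=
      (continuous_id.prodMk (hf (n + k))).tendsto x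
    exact hn.eventually (hh _ c' (hc'.trans_le (inf_le_right.trans (iInf_le _ n))))
  have hgx : Tendsto (fun x' => (x', g x')) (𝓝 x) (𝓝 (x, g x)) :=
    (continuous_id.prodMk hg).tendsto x
  filter_upwards [hq, hfin, hgx.eventually (hh _ c' (hc'.trans_le inf_le_left))]
    with x' hqx hfx hgx'
  refine hcc'.trans_le (le_inf hgx'.le (le_iInf fun n => ?_))
  rcases lt_or_ge n N with hn | hn
  · exact (hfx n (Finset.mem_range.2 hn)).le
  · exact (hpq (hN (n + k) (hn.trans (Nat.le_add_right n k))) hqx).le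

/-- The tail infima of the values of a lower semicontinuous function along a convergent sequence
of points, together with the value at the limit, increase to the value at the limit. -/
theorem LowerSemicontinuous.iSup_inf_iInf_tail {Z : Type*} [TopologicalSpace Z] {h : Z → ℝ≥0∞}
    (hh : LowerSemicontinuous h) {z : ℕ → Z} {w : Z} (hz : Tendsto z atTop (𝓝 w)) :
    ⨆ k, (h w ⊓ ⨅ n, h (z (n + k))) = h w := by
  refine le_antisymm (iSup_le fun k => inf_le_left) (le_of_forall_lt fun c hc => ?_)
  obtain ⟨c', hcc', hc'⟩ := exists_between hc
  obtain ⟨N, hN⟩ := eventually_atTop.1 (hz.eventually (hh w c' hc'))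
  refine hcc'.trans_le (le_iSup_of_le N (le_inf hc'.le (le_iInf fun n => ?_)))
  exact (hN _ (Nat.le_add_left N n)).le

/-! ### Compactness of plans and the lifted cost -/

/-- Couplings of a convergent sequence of measures with a fixed measure have a convergent
subsequence, whose limit couples the limit measures. -/
theorem exists_tendsto_couplings {X Y : Type*}
    [TopologicalSpace X] [PolishSpace X] [MeasurableSpace X] [BorelSpace X]
    [TopologicalSpace Y] [PolishSpace Y] [MeasurableSpace Y] [BorelSpace Y]
    {μs : ℕ → ProbabilityMeasure X} {μ : ProbabilityMeasure X} (hμ : Tendsto μs atTop (𝓝 μ))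
    {ν : ProbabilityMeasure Y} {γs : ℕ → ProbabilityMeasure (X × Y)}
    (hγ : ∀ n, γs n ∈ couplings (μs n) ν) :
    ∃ γ ∈ couplings μ ν, ∃ φ : ℕ → ℕ, StrictMono φ ∧ Tendsto (γs ∘ φ) atTop (𝓝 γ) := by
  let := TopologicalSpace.upgradeIsCompletelyMetrizable X
  have hX : IsTightMeasureSet
      {((m : ProbabilityMeasure X) : Measure X) | m ∈ insert μ (Set.range μs)} := by
    refine isTightMeasureSet_of_isCompact_closure ?_
    rw [hμ.isCompact_insert_range.isClosed.closure_eq]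
    exact hμ.isCompact_insert_range
  have hT : IsTightMeasureSet
      {((m : ProbabilityMeasure (X × Y)) : Measure (X × Y)) | m ∈ Set.range γs} := by
    refine IsTightMeasureSet.prodMk (hX.subset ?_)
      ((isTightMeasureSet_singleton (μ := (ν : Measure Y))).subset ?_)
    · rintro _ ⟨_, ⟨_, ⟨n, rfl⟩, rfl⟩, rfl⟩
      exact ⟨μs n, Or.inr ⟨n, rfl⟩, (hγ n).1.symm⟩
    · rintro _ ⟨_, ⟨_, ⟨n, rfl⟩, rfl⟩, rfl⟩
      exact (hγ n).2
  obtain ⟨γ, -, φ, hφ, hlim⟩ := (isCompact_closure_of_isTightMeasureSet hT).tendsto_subseq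
    fun n => subset_closure (Set.mem_range_self (f := γs) n)
  refine ⟨γ, ⟨?_, ?_⟩, φ, hφ, hlim⟩
  · have h1 := ProbabilityMeasure.tendsto_map_of_tendsto_of_continuous _ _ hlim continuous_fst
    have h2 : Tendsto (μs ∘ φ) atTop (𝓝 (γ.map continuous_fst.measurable.aemeasurable)) :=
      h1.congr fun n => Subtype.ext (hγ (φ n)).1
    have h3 := tendsto_nhds_unique h2 (hμ.comp hφ.tendsto_atTop)
    exact congrArg ProbabilityMeasure.toMeasure h3
  · have h1 := ProbabilityMeasure.tendsto_map_of_tendsto_of_continuous _ _ hlim continuous_snd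
    have h2 : Tendsto (fun _ : ℕ => ν) atTop
        (𝓝 (γ.map continuous_snd.measurable.aemeasurable)) :=
      h1.congr fun n => Subtype.ext (hγ (φ n)).2
    have h3 := tendsto_nhds_unique h2 tendsto_const_nhds
    exact congrArg ProbabilityMeasure.toMeasure h3

section LiftedCost

variable {X U Y : Type*}
  [TopologicalSpace X] [PolishSpace X] [MeasurableSpace X] [BorelSpace X] [TopologicalSpace U]
  [TopologicalSpace Y] [PolishSpace Y] [MeasurableSpace Y] [BorelSpace Y]
  {l : X × U × Y → ℝ≥0∞}

/-- Lower semicontinuity of the transport cost along convergent plans with a fixed second marginal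
and convergent maps. -/
theorem lintegral_cost_le_liminf
    (hl_meas : ∀ u : C(X × Y, U), Measurable fun p : X × Y => l (p.1, u p, p.2))
    (hl_lsc : ∀ y : Y, LowerSemicontinuous fun z : X × U => l (z.1, z.2, y))
    {ν : Measure Y} [IsFiniteMeasure ν] {γ : ProbabilityMeasure (X × Y)}
    {γs : ℕ → ProbabilityMeasure (X × Y)} (hlim : Tendsto γs atTop (𝓝 γ))
    (hsnd : ∀ i, (γs i : Measure (X × Y)).map Prod.snd = ν)
    {us : ℕ → C(X × Y, U)} {u : C(X × Y, U)} (hu : Tendsto us atTop (𝓝 u)) :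
    ∫⁻ p, l (p.1, u p, p.2) ∂(γ : Measure (X × Y))
      ≤ liminf (fun n => ∫⁻ p, l (p.1, us n p, p.2) ∂(γs n : Measure (X × Y))) atTop := by
  -- Without the term at `u`, the tail infimum could exceed the limit cost, and semicontinuity in
  -- `x` could fail.
  let g : ℕ → X × Y → ℝ≥0∞ := fun k p =>
    l (p.1, u p, p.2) ⊓ ⨅ n, l (p.1, us (n + k) p, p.2)
  have hg_meas (k) : Measurable (g k) := (hl_meas u).inf (.iInf fun n => hl_meas _)
  have hg_mono : Monotone g := by
    intro k k' hk p
    refine inf_le_inf_left _ (le_iInf fun n => ?_)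
    refine (iInf_le _ (n + (k' - k))).trans_eq ?_
    rw [add_assoc, Nat.sub_add_cancel hk]
  have hg_sup (p : X × Y) : ⨆ k, g k p = l (p.1, u p, p.2) :=
    (hl_lsc p.2).iSup_inf_iInf_tail (z := fun n => (p.1, us n p)) (w := (p.1, u p))
      (tendsto_const_nhds.prodMk_nhds
        (ContinuousMap.tendsto_apply_of_tendsto_seq hu tendsto_const_nhds))
  have hg_lsc (k) (y : Y) : LowerSemicontinuous fun x => g k (x, y) := by
    refine lowerSemicontinuous_inf_iInf_tail (hl_lsc y) (f := fun n x => us n (x, y))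
      (g := fun x => u (x, y)) (fun n => by fun_prop) (by fun_prop) (fun x => ?_) k
    have hy : Tendsto (fun q : ℕ × X => (q.1, (q.2, y))) (atTop ×ˢ 𝓝 x) (atTop ×ˢ 𝓝 (x, y)) :=
      tendsto_fst.prodMk (tendsto_snd.prodMk_nhds tendsto_const_nhds)
    exact (ContinuousMap.tendsto_uncurry_of_tendsto hu (x, y)).comp hy
  simp_rw [← hg_sup]
  rw [lintegral_iSup hg_meas hg_mono]
  refine iSup_le fun k => ?_
  refine (lintegral_le_liminf_of_lowerSemicontinuous_section hlim hsnd (hg_meas k)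
    (hg_lsc k)).trans (liminf_le_liminf ?_)
  filter_upwards [eventually_ge_atTop k] with n hn
  refine lintegral_mono fun p => ?_
  simp only
  refine inf_le_right.trans ((iInf_le _ (n - k)).trans_eq ?_)
  rw [Nat.sub_add_cancel hn]

/-- The lifted cost is sequentially lower semicontinuous. -/
theorem seqLowerSemicontinuous_liftedCost
    (hl_meas : ∀ u : C(X × Y, U), Measurable fun p : X × Y => l (p.1, u p, p.2))
    (hl_lsc : ∀ y : Y, LowerSemicontinuous fun z : X × U => l (z.1, z.2, y))
    (ν : ProbabilityMeasure Y) : SeqLowerSemicontinuous (liftedCost l ν) := by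
  intro a e ha
  by_contra! hlt
  obtain ⟨c, hc, hce⟩ := exists_between hlt
  obtain ⟨ψ, hψ, hψc⟩ := extraction_of_frequently_atTop
    (frequently_lt_of_liminf_lt (by isBoundedDefault) hc)
  have hex (n) : ∃ γ ∈ couplings (a (ψ n)).1 ν,
      ∫⁻ p, l (p.1, (a (ψ n)).2 p, p.2) ∂(γ : Measure (X × Y)) < c := by
    simpa only [liftedCost, iInf_lt_iff, exists_prop] using hψc n
  choose γs hγs hγc using hex
  have haψ := ha.comp hψ.tendsto_atTop
  obtain ⟨γ, hγ, φ, hφ, hlim⟩ := exists_tendsto_couplings haψ.fst_nhds hγs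
  have hle := lintegral_cost_le_liminf hl_meas hl_lsc hlim
    (fun i => (hγs (φ i)).2) (haψ.snd_nhds.comp hφ.tendsto_atTop)
  refine hce.not_ge ((iInf₂_le γ hγ).trans (hle.trans ?_))
  refine liminf_le_of_le (by isBoundedDefault) fun b hb => ?_
  obtain ⟨n, hn⟩ := hb.exists
  exact hn.trans (hγc (φ n)).le

end LiftedCost

/-- In first countable spaces, sequential lower semicontinuity implies lower semicontinuity. -/
theorem SeqLowerSemicontinuous.lowerSemicontinuous {E : Type*} [TopologicalSpace E]
    [FirstCountableTopology E] {f : E → ℝ≥0∞} (hf : SeqLowerSemicontinuous f) :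
    LowerSemicontinuous f := by
  intro e c hc
  by_contra hev
  obtain ⟨a, ha, hac⟩ := exists_seq_forall_of_frequently (not_eventually.1 hev)
  refine hc.not_ge ((hf a e ha).trans (liminf_le_of_le (by isBoundedDefault) fun b hb => ?_))
  obtain ⟨n, hn⟩ := hb.exists
  exact hn.trans (not_lt.1 (hac n))

/-- `ProbabilityMeasure X` carries the narrow topology, `C(X × Y, U)` the compact-open topology
(uniform convergence on compact sets), and their product the product topology. -/
theorem mainTheorem3 {X U Y : Type*}
    [TopologicalSpace X] [PolishSpace X] [MeasurableSpace X] [BorelSpace X]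
    [TopologicalSpace U] [TopologicalSpace.MetrizableSpace U]
    [TopologicalSpace Y] [PolishSpace Y] [MeasurableSpace Y] [BorelSpace Y]
    (l : X × U × Y → ℝ≥0∞)
    (hl_meas : ∀ u : C(X × Y, U), Measurable fun p : X × Y => l (p.1, u p, p.2))
    (hl_lsc : ∀ y : Y, LowerSemicontinuous fun z : X × U => l (z.1, z.2, y))
    (μstar : ProbabilityMeasure Y) :
    SeqLowerSemicontinuous (liftedCost l μstar) ∧
    (LocallyCompactSpace X → LocallyCompactSpace Y →
      LowerSemicontinuous (liftedCost l μstar)) := by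
  have hseq := seqLowerSemicontinuous_liftedCost hl_meas hl_lsc μstar
  refine ⟨hseq, fun _ _ => ?_⟩
  -- With `X × Y` locally compact and σ-compact, a metric on `U` makes `C(X × Y, U)` first
  -- countable.
  let := TopologicalSpace.metrizableSpaceMetric U
  exact hseq.lowerSemicontinuous
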